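/- Let $g\colon\mathbb R^n\to\mathbb R^m$ be smooth and let $q_0,q_N\in\mathbb R^n$. Call $(u,\lambda)\in C^\infty([0,1],\mathbb R^n\times\mathbb R^m)$ with associated state $q\in C^\infty([0,1],\mathbb R^n)$ admissible if $\dot q=u$ on $[0,1]$, $q(0)=q_0$ and $q(1)=q_N$. On admissible controls consider the cost $$J(u,\lambda)=\int_0^1\Bigl(\tfrac12\|u(t)\|^2-g(q(t))^\top\lambda(t)\Bigr)\,dt .$$ Let $(u,\lambda)$, with associated state $q$, be an admissible control that is optimal in the sense that it extremises $J$, i.e. it is a local (in particular, possibly global) minimiser or maximiser of $J$ among the admissible controls with respect to uniform distance of $(u,\lambda,q)$ on $[0,1]$, or, more generally, a stationary point of $J$: for all $v\in C^\infty([0,1],\mathbb R^n)$ with $v(0)=v(1)=0$ and all $w\in C^\infty([0,1],\mathbb R^m)$, $$\frac{d}{d\varepsilon}\Big|_{\varepsilon=0}J(u+\varepsilon\dot v,\lambda+\varepsilon w)=0,$$ where the control $(u+\varepsilon\dot v,\lambda+\varepsilon w)$ has associated state $q+\varepsilon v$. Then there is a costate trajectory $p\in C^\infty([0,1],\mathbb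 R^n)$ such that on $[0,1]$ $$\dot q=u,\qquad \dot p=-g'(q)^\top\lambda,$$ subject to the algebraic constraints $g(q)=0$ and $p=u$, and the boundary conditions $q(0)=q_0$, $q(1)=q_N$. -/

import Mathlib

open scoped ContDiff

noncomputable section

namespace GeodesicOCP

/-- Smooth controls `(u, lam)` on `[0,1]` together with the associated smooth state `q`:
`q' = u` on `[0,1]`, `q 0 = a`, `q 1 = b`.  (Only the values on `[0,1]` matter.) -/
structure IsAdmissible {n m : ℕ} (a b : EuclideanSpace ℝ (Fin n))
    (u : ℝ → EuclideanSpace ℝ (Fin n)) (lam : ℝ → EuclideanSpace ℝ (Fin m))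
    (q : ℝ → EuclideanSpace ℝ (Fin n)) : Prop where
  smooth_control : ContDiffOn ℝ ∞ u (Set.Icc 0 1)
  smooth_multiplier : ContDiffOn ℝ ∞ lam (Set.Icc 0 1)
  smooth_state : ContDiffOn ℝ ∞ q (Set.Icc 0 1)
  state_eq : ∀ t ∈ Set.Icc (0 : ℝ) 1, HasDerivWithinAt q (u t) (Set.Icc 0 1) t
  left : q 0 = a
  right : q 1 = b

/-- The cost `∫₀¹ (½‖u‖² - g(q)ᵀ lam) dt` of the controls `(u, lam)` with associated state `q`. -/
def cost {n m : ℕ} (g : EuclideanSpace ℝ (Fin n) → EuclideanSpace ℝ (Fin m))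
    (u : ℝ → EuclideanSpace ℝ (Fin n)) (lam : ℝ → EuclideanSpace ℝ (Fin m))
    (q : ℝ → EuclideanSpace ℝ (Fin n)) : ℝ :=
  ∫ t in (0 : ℝ)..1, ((1 / 2 : ℝ) * ‖u t‖ ^ 2 - inner ℝ (g (q t)) (lam t))

/-- The triples `(u', lam', q')` whose values are `δ`-close to `(u, lam, q)` on `[0,1]`. -/
def IsClose {n m : ℕ} (δ : ℝ)
    (u u' : ℝ → EuclideanSpace ℝ (Fin n)) (lam lam' : ℝ → EuclideanSpace ℝ (Fin m))
    (q q' : ℝ → EuclideanSpace ℝ (Fin n)) : Prop :=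
  ∀ t ∈ Set.Icc (0 : ℝ) 1, ‖u' t - u t‖ < δ ∧ ‖lam' t - lam t‖ < δ ∧ ‖q' t - q t‖ < δ

/-- (Weak) local minimisers of the cost among the admissible controls; every global minimiser
is one. -/
def IsLocalMinimiser {n m : ℕ} (g : EuclideanSpace ℝ (Fin n) → EuclideanSpace ℝ (Fin m))
    (a b : EuclideanSpace ℝ (Fin n))
    (u : ℝ → EuclideanSpace ℝ (Fin n)) (lam : ℝ → EuclideanSpace ℝ (Fin m))
    (q : ℝ → EuclideanSpace ℝ (Fin n)) : Prop :=
  ∃ δ > 0, ∀ u' lam' q', IsAdmissible a b u' lam' q' → IsClose δ u u' lam lam' q q' →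
    cost g u lam q ≤ cost g u' lam' q'

/-- (Weak) local maximisers of the cost among the admissible controls. -/
def IsLocalMaximiser {n m : ℕ} (g : EuclideanSpace ℝ (Fin n) → EuclideanSpace ℝ (Fin m))
    (a b : EuclideanSpace ℝ (Fin n))
    (u : ℝ → EuclideanSpace ℝ (Fin n)) (lam : ℝ → EuclideanSpace ℝ (Fin m))
    (q : ℝ → EuclideanSpace ℝ (Fin n)) : Prop :=
  ∃ δ > 0, ∀ u' lam' q', IsAdmissible a b u' lam' q' → IsClose δ u u' lam lam' q q' →
    cost g u' lam' q' ≤ cost g u lam q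

/-- The first variation of the cost vanishes: the directional derivative is zero along every
smooth variation `(η, w)` of the controls, with associated variation `v` of the state, that keeps
the endpoints fixed (`v' = η`, `v 0 = 0 = v 1`). -/
def IsStationary {n m : ℕ} (g : EuclideanSpace ℝ (Fin n) → EuclideanSpace ℝ (Fin m))
    (u : ℝ → EuclideanSpace ℝ (Fin n)) (lam : ℝ → EuclideanSpace ℝ (Fin m))
    (q : ℝ → EuclideanSpace ℝ (Fin n)) : Prop :=
  ∀ (η : ℝ → EuclideanSpace ℝ (Fin n)) (w : ℝ → EuclideanSpace ℝ (Fin m))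
    (v : ℝ → EuclideanSpace ℝ (Fin n)), IsAdmissible 0 0 η w v →
    HasDerivAt (fun ε : ℝ => cost g (u + ε • η) (lam + ε • w) (q + ε • v)) 0 0

/-- Optimal controls, in the sense of extremising the cost: admissible, and a local minimiser,
a local maximiser or a stationary point of the cost.  (The cost is affine in `lam`, so apart from
degenerate `g` its extremals are saddle points; the stationary case is the essential one.) -/
def IsOptimal {n m : ℕ} (g : EuclideanSpace ℝ (Fin n) → EuclideanSpace ℝ (Fin m))
    (a b : EuclideanSpace ℝ (Fin n))
    (u : ℝ → EuclideanSpace ℝ (Fin n)) (lam : ℝ → EuclideanSpace ℝ (Fin m))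
    (q : ℝ → EuclideanSpace ℝ (Fin n)) : Prop :=
  IsAdmissible a b u lam q ∧
    (IsLocalMinimiser g a b u lam q ∨ IsLocalMaximiser g a b u lam q ∨ IsStationary g u lam q)

end GeodesicOCP

end

/-! The multiplier enters the cost linearly, so varying it alone forces `g (q t) = 0`, while varying
the state gives the Euler-Lagrange equation `u' = -g'(q)ᵀ lam`; hence the costate can be `u` itself.
All three notions of optimality reduce to a vanishing first variation
(`IsOptimal.first_variation_eq_zero`). Since all data are smooth, the residual of each equation,
with a weight vanishing at the endpoints for the second, is itself a legitimate test variation. The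
first variation then becomes, up to sign, the integral of a nonnegative continuous function, which
must vanish; no bump functions are needed. -/

open Set in
/-- A nonnegative continuous function on an interval with zero integral vanishes. -/
theorem ContinuousOn.eq_zero_of_intervalIntegral_eq_zero {f : ℝ → ℝ} {a b : ℝ} (hab : a < b)
    (hf : ContinuousOn f (Icc a b)) (h0 : ∀ t ∈ Icc a b, 0 ≤ f t)
    (hint : ∫ t in a..b, f t = 0) : ∀ t ∈ Icc a b, f t = 0 := by
  intro t ht
  by_contra hne
  exact (intervalIntegral.integral_pos hab hf (fun x hx => h0 x (Ioc_subset_Icc_self hx))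
    ⟨t, ht, lt_of_le_of_ne (h0 t ht) (Ne.symm hne)⟩).ne' hint

namespace GeodesicOCP

open Set Filter Topology

variable {n m : ℕ} {g : EuclideanSpace ℝ (Fin n) → EuclideanSpace ℝ (Fin m)}
  {a b : EuclideanSpace ℝ (Fin n)} {u η q v : ℝ → EuclideanSpace ℝ (Fin n)}
  {lam w : ℝ → EuclideanSpace ℝ (Fin m)}

theorem hasDerivAt_integrand (hg : Differentiable ℝ g) (x y r s : EuclideanSpace ℝ (Fin n))
    (l k : EuclideanSpace ℝ (Fin m)) (ε : ℝ) :
    HasDerivAt (fun ε : ℝ => (1 / 2 : ℝ) * ‖x + ε • y‖ ^ 2 - inner ℝ (g (r + ε • s)) (l + ε • k))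
      (inner ℝ (x + ε • y) y - (inner ℝ (g (r + ε • s)) k +
        inner ℝ (fderiv ℝ g (r + ε • s) s) (l + ε • k))) ε := by
  have line {N : ℕ} (c d : EuclideanSpace ℝ (Fin N)) :
      HasDerivAt (fun ε : ℝ => c + ε • d) d ε := by
    simpa using ((hasDerivAt_id ε).smul_const d).const_add c
  have h1 := ((line x y).norm_sq).const_mul (1 / 2 : ℝ)
  have h2 := ((hg (r + ε • s)).hasFDerivAt.comp_hasDerivAt ε (line r s)).inner ℝ (line l k)
  refine (h1.sub h2).congr_deriv ?_
  simp only [Function.comp_apply]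
  ring

/-- The first variation of the cost. -/
theorem hasDerivAt_cost (hg : ContDiff ℝ ∞ g) (h : IsAdmissible a b u lam q)
    (hv : IsAdmissible 0 0 η w v) :
    HasDerivAt (fun ε : ℝ => cost g (u + ε • η) (lam + ε • w) (q + ε • v))
      (∫ t in (0 : ℝ)..1, (inner ℝ (u t) (η t) - (inner ℝ (g (q t)) (w t) +
        inner ℝ (fderiv ℝ g (q t) (v t)) (lam t)))) 0 := by
  -- Compactness in both `ε` and `t` bounds `F'` by a constant, which serves as the dominating
  -- function.
  let K : Set (ℝ × ℝ) := Icc (-1 : ℝ) 1 ×ˢ Icc (0 : ℝ) 1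
  have lift {N : ℕ} {f : ℝ → EuclideanSpace ℝ (Fin N)} (hf : ContDiffOn ℝ ∞ f (Icc 0 1)) :
      ContinuousOn (fun z : ℝ × ℝ => f z.2) K :=
    hf.continuousOn.comp continuousOn_snd fun z hz => hz.2
  have hu := lift h.smooth_control
  have hl := lift h.smooth_multiplier
  have hq := lift h.smooth_state
  have hη := lift hv.smooth_control
  have hw := lift hv.smooth_multiplier
  have hv' := lift hv.smooth_state
  have hfst : ContinuousOn (fun z : ℝ × ℝ => z.1) K := continuousOn_fst
  have hqv := hq.add (hfst.smul hv')
  have hgq := hg.continuous.comp_continuousOn hqv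
  have hdg := ((hg.continuous_fderiv (by simp)).comp_continuousOn hqv).clm_apply hv'
  let F : ℝ → ℝ → ℝ := fun ε t => (1 / 2 : ℝ) * ‖u t + ε • η t‖ ^ 2 -
    inner ℝ (g (q t + ε • v t)) (lam t + ε • w t)
  let F' : ℝ → ℝ → ℝ := fun ε t => inner ℝ (u t + ε • η t) (η t) -
    (inner ℝ (g (q t + ε • v t)) (w t) +
      inner ℝ (fderiv ℝ g (q t + ε • v t) (v t)) (lam t + ε • w t))
  have hF : ContinuousOn (fun z : ℝ × ℝ => F z.1 z.2) K :=
    (continuousOn_const.mul ((hu.add (hfst.smul hη)).norm.pow 2)).sub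
      (hgq.inner (hl.add (hfst.smul hw)))
  have hF' : ContinuousOn (fun z : ℝ × ℝ => F' z.1 z.2) K :=
    ((hu.add (hfst.smul hη)).inner hη).sub
      ((hgq.inner hw).add (hdg.inner (hl.add (hfst.smul hw))))
  have slice {G : ℝ → ℝ → ℝ} (hG : ContinuousOn (fun z : ℝ × ℝ => G z.1 z.2) K) {ε : ℝ}
      (hε : ε ∈ Icc (-1 : ℝ) 1) : IntervalIntegrable (G ε) MeasureTheory.volume 0 1 := by
    apply ContinuousOn.intervalIntegrable
    rw [uIcc_of_le zero_le_one]
    exact hG.comp (f := fun t : ℝ => (ε, t)) (by fun_prop) fun t ht => ⟨hε, ht⟩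
  obtain ⟨C, hC⟩ := (isCompact_Icc.prod isCompact_Icc : IsCompact K).exists_bound_of_continuousOn hF'
  have h0 : (0 : ℝ) ∈ Icc (-1 : ℝ) 1 := by norm_num
  have hs : Icc (-1 : ℝ) 1 ∈ 𝓝 (0 : ℝ) := Icc_mem_nhds (by norm_num) (by norm_num)
  have key := (intervalIntegral.hasDerivAt_integral_of_dominated_loc_of_deriv_le
    (F := F) (F' := F') (bound := fun _ => C) (μ := MeasureTheory.volume) (a := 0) (b := 1) hs
    (by filter_upwards [hs] with ε hε using (slice hF hε).aestronglyMeasurable_restrict_uIoc)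
    (slice hF h0) (slice hF' h0).aestronglyMeasurable_restrict_uIoc
    (Eventually.of_forall fun t ht ε hε => by
      rw [uIoc_of_le zero_le_one] at ht
      exact hC (ε, t) ⟨hε, Ioc_subset_Icc_self ht⟩)
    intervalIntegrable_const
    (Eventually.of_forall fun t _ ε _ =>
      hasDerivAt_integrand (hg.differentiable (by simp)) _ _ _ _ _ _ ε)).2
  simpa [F, F', cost] using key

theorem IsAdmissible.add_smul (h : IsAdmissible a b u lam q) (hv : IsAdmissible 0 0 η w v)
    (ε : ℝ) : IsAdmissible a b (u + ε • η) (lam + ε • w) (q + ε • v) where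
  smooth_control := h.smooth_control.add (hv.smooth_control.const_smul ε)
  smooth_multiplier := h.smooth_multiplier.add (hv.smooth_multiplier.const_smul ε)
  smooth_state := h.smooth_state.add (hv.smooth_state.const_smul ε)
  state_eq t ht := (h.state_eq t ht).add ((hv.state_eq t ht).const_smul ε)
  left := by simp [h.left, hv.left]
  right := by simp [h.right, hv.right]

/-- Small multiples of a variation stay uniformly close to the given controls. -/
theorem IsAdmissible.eventually_isClose (hv : IsAdmissible 0 0 η w v) {δ : ℝ} (hδ : 0 < δ) :
    ∀ᶠ ε : ℝ in 𝓝 0, IsClose δ u (u + ε • η) lam (lam + ε • w) q (q + ε • v) := by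
  have small {N : ℕ} {f : ℝ → EuclideanSpace ℝ (Fin N)} (hf : ContDiffOn ℝ ∞ f (Icc 0 1)) :
      ∀ᶠ ε : ℝ in 𝓝 0, ∀ t ∈ Icc (0 : ℝ) 1, ‖ε • f t‖ < δ := by
    obtain ⟨C, hC⟩ := isCompact_Icc.exists_bound_of_continuousOn hf.continuousOn
    have hlim : Tendsto (fun ε : ℝ => |ε| * C) (𝓝 0) (𝓝 0) := by
      have : Continuous fun ε : ℝ => |ε| * C := by fun_prop
      simpa using this.tendsto 0
    filter_upwards [hlim.eventually_lt_const hδ] with ε hε t ht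
    rw [norm_smul, Real.norm_eq_abs]
    exact (mul_le_mul_of_nonneg_left (hC t ht) (abs_nonneg ε)).trans_lt hε
  filter_upwards [small hv.smooth_control, small hv.smooth_multiplier, small hv.smooth_state]
    with ε h1 h2 h3 t ht
  simpa using ⟨h1 t ht, h2 t ht, h3 t ht⟩

/-- Fermat's rule along `ε ↦ (u + ε • η, lam + ε • w, q + ε • v)` settles the extremal cases;
uniqueness of derivatives settles the stationary one. -/
theorem IsOptimal.first_variation_eq_zero (hg : ContDiff ℝ ∞ g) (h : IsOptimal g a b u lam q)
    (hv : IsAdmissible 0 0 η w v) :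
    ∫ t in (0 : ℝ)..1, (inner ℝ (u t) (η t) - (inner ℝ (g (q t)) (w t) +
      inner ℝ (fderiv ℝ g (q t) (v t)) (lam t))) = 0 := by
  obtain ⟨hadm, ⟨δ, hδ, hmin⟩ | ⟨δ, hδ, hmax⟩ | hstat⟩ := h
  · refine IsLocalMin.hasDerivAt_eq_zero ?_ (hasDerivAt_cost hg hadm hv)
    filter_upwards [hv.eventually_isClose hδ] with ε hε
    simpa using hmin _ _ _ (hadm.add_smul hv ε) hε
  · refine IsLocalMax.hasDerivAt_eq_zero ?_ (hasDerivAt_cost hg hadm hv)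
    filter_upwards [hv.eventually_isClose hδ] with ε hε
    simpa using hmax _ _ _ (hadm.add_smul hv ε) hε
  · exact (hasDerivAt_cost hg hadm hv).unique (hstat η w v hv)

theorem IsOptimal.constraint (hg : ContDiff ℝ ∞ g) (h : IsOptimal g a b u lam q) :
    ∀ t ∈ Icc (0 : ℝ) 1, g (q t) = 0 := by
  have hgq : ContDiffOn ℝ ∞ (fun t => g (q t)) (Icc 0 1) := hg.comp_contDiffOn h.1.smooth_state
  -- With the state frozen and `w = g ∘ q`, the first variation is `-∫ ‖g (q t)‖²`.
  have hv : IsAdmissible (0 : EuclideanSpace ℝ (Fin n)) 0 (fun _ => 0) (fun t => g (q t))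
      (fun _ => 0) :=
    ⟨contDiffOn_const, hgq, contDiffOn_const, fun t _ => hasDerivWithinAt_const _ _ _, rfl, rfl⟩
  have hint := h.first_variation_eq_zero hg hv
  simp only [inner_zero_right, map_zero, inner_zero_left, add_zero, zero_sub,
    intervalIntegral.integral_neg, neg_eq_zero] at hint
  intro t ht
  exact inner_self_eq_zero.1 (ContinuousOn.eq_zero_of_intervalIntegral_eq_zero zero_lt_one
    (hgq.continuousOn.inner hgq.continuousOn) (fun _ _ => real_inner_self_nonneg) hint t ht)

theorem contDiffOn_adjoint_fderiv (hg : ContDiff ℝ ∞ g) {s : Set ℝ} (hq : ContDiffOn ℝ ∞ q s)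
    (hl : ContDiffOn ℝ ∞ lam s) :
    ContDiffOn ℝ ∞ (fun t => ContinuousLinearMap.adjoint (fderiv ℝ g (q t)) (lam t)) s := by
  -- Coordinate `i` of the adjoint term is the inner product of `fderiv ℝ g (q t) eᵢ` with `lam t`,
  -- so the adjoint need not be differentiated.
  rw [contDiffOn_euclidean]
  intro i
  have hd : ContDiffOn ℝ ∞ (fun t => fderiv ℝ g (q t)) s :=
    (hg.fderiv_right (m := ∞) (by simp)).comp_contDiffOn hq
  refine ((hd.clm_apply (contDiffOn_const (c := EuclideanSpace.single i (1 : ℝ)))).inner ℝ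
    hl).congr fun t _ => ?_
  rw [← ContinuousLinearMap.adjoint_inner_right, EuclideanSpace.inner_single_left]
  simp

/-- Integration by parts against a variation vanishing at the end points. -/
theorem integral_inner_add_inner_eq_zero {u' : ℝ → EuclideanSpace ℝ (Fin n)}
    (hu : ∀ t ∈ Icc (0 : ℝ) 1, HasDerivWithinAt u (u' t) (Icc 0 1) t)
    (hu' : ContinuousOn u' (Icc 0 1)) (hv : IsAdmissible 0 0 η w v) :
    ∫ t in (0 : ℝ)..1, (inner ℝ (u t) (η t) + inner ℝ (u' t) (v t)) = 0 := by
  have hcu : ContinuousOn u (Icc 0 1) := fun t ht => (hu t ht).continuousWithinAt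
  have hcv := hv.smooth_state.continuousOn
  rw [intervalIntegral.integral_eq_sub_of_hasDerivAt_of_le zero_le_one (hcu.inner hcv)
    (fun t ht => ?_) ?_]
  · simp [hv.left, hv.right]
  · apply ContinuousOn.intervalIntegrable
    rw [uIcc_of_le zero_le_one]
    exact (hcu.inner hv.smooth_control.continuousOn).add (hu'.inner hcv)
  · exact ((hu t (Ioo_subset_Icc_self ht)).hasDerivAt (Icc_mem_nhds ht.1 ht.2)).inner ℝ
      ((hv.state_eq t (Ioo_subset_Icc_self ht)).hasDerivAt (Icc_mem_nhds ht.1 ht.2))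

/-- The Euler-Lagrange equation of the cost. -/
theorem IsOptimal.hasDerivWithinAt_control (hg : ContDiff ℝ ∞ g) (h : IsOptimal g a b u lam q) :
    ∀ t ∈ Icc (0 : ℝ) 1, HasDerivWithinAt u
      (-(ContinuousLinearMap.adjoint (fderiv ℝ g (q t)) (lam t))) (Icc 0 1) t := by
  have hsu := h.1.smooth_control
  let A : ℝ → EuclideanSpace ℝ (Fin n) :=
    fun t => ContinuousLinearMap.adjoint (fderiv ℝ g (q t)) (lam t)
  let f : ℝ → EuclideanSpace ℝ (Fin n) := fun t => derivWithin u (Icc 0 1) t + A t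
  -- The residual `f` tests itself; the weight makes `v` vanish at both endpoints and is positive
  -- between them.
  let v : ℝ → EuclideanSpace ℝ (Fin n) := fun t => (t * (1 - t)) • f t
  have hud : UniqueDiffOn ℝ (Icc (0 : ℝ) 1) := uniqueDiffOn_Icc zero_lt_one
  have hA : ContDiffOn ℝ ∞ A (Icc 0 1) :=
    contDiffOn_adjoint_fderiv hg h.1.smooth_state h.1.smooth_multiplier
  have hu' : ContDiffOn ℝ ∞ (derivWithin u (Icc 0 1)) (Icc 0 1) := hsu.derivWithin hud (by simp)
  have hdu : ∀ t ∈ Icc (0 : ℝ) 1, HasDerivWithinAt u (derivWithin u (Icc 0 1) t) (Icc 0 1) t :=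
    fun t ht => (hsu.differentiableOn (by simp) t ht).hasDerivWithinAt
  have hf : ContDiffOn ℝ ∞ f (Icc 0 1) := hu'.add hA
  have hvs : ContDiffOn ℝ ∞ v (Icc 0 1) :=
    (ContDiff.contDiffOn (f := fun t : ℝ => t * (1 - t)) (by fun_prop)).smul hf
  have hv : IsAdmissible 0 0 (derivWithin v (Icc 0 1))
      (fun _ => (0 : EuclideanSpace ℝ (Fin m))) v :=
    ⟨hvs.derivWithin hud (by simp), contDiffOn_const, hvs,
      fun t ht => (hvs.differentiableOn (by simp) t ht).hasDerivWithinAt, by simp [v], by simp [v]⟩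
  have h1 := h.first_variation_eq_zero hg hv
  have h2 := integral_inner_add_inner_eq_zero hdu hu'.continuousOn hv
  have hAv : ∀ t, inner ℝ (fderiv ℝ g (q t) (v t)) (lam t) = inner ℝ (A t) (v t) := fun t => by
    rw [← ContinuousLinearMap.adjoint_inner_right, real_inner_comm]
  simp only [inner_zero_right, zero_add, hAv] at h1
  have hcv := hvs.continuousOn
  have hη := hv.smooth_control.continuousOn
  have hint : ∫ t in (0 : ℝ)..1, (t * (1 - t)) * inner ℝ (f t) (f t) = 0 := by
    -- Subtracting the first variation from the integration by parts cancels `⟨u, v'⟩` and leaves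
    -- `⟨f, v⟩`.
    have hsub := intervalIntegral.integral_sub (μ := MeasureTheory.volume) (a := 0) (b := 1)
      (ContinuousOn.intervalIntegrable_of_Icc zero_le_one
        ((hsu.continuousOn.inner (𝕜 := ℝ) hη).add (hu'.continuousOn.inner (𝕜 := ℝ) hcv)))
      (ContinuousOn.intervalIntegrable_of_Icc zero_le_one
        ((hsu.continuousOn.inner (𝕜 := ℝ) hη).sub (hA.continuousOn.inner (𝕜 := ℝ) hcv)))
    simp only [Pi.add_apply, Pi.sub_apply] at hsub
    rw [h1, h2, sub_self] at hsub
    refine (intervalIntegral.integral_congr fun t _ => ?_).trans hsub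
    simp only [v, f, inner_smul_right, inner_add_right, inner_add_left]
    ring
  have hzero := ContinuousOn.eq_zero_of_intervalIntegral_eq_zero zero_lt_one
    ((Continuous.continuousOn (f := fun t : ℝ => t * (1 - t)) (by fun_prop)).mul
      (hf.continuousOn.inner hf.continuousOn))
    (fun t ht => mul_nonneg (mul_nonneg ht.1 (sub_nonneg.2 ht.2)) real_inner_self_nonneg) hint
  have hf0 : EqOn f (fun _ => 0) (Ioo 0 1) := fun t ht =>
    inner_self_eq_zero.1 ((mul_eq_zero.1 (hzero t (Ioo_subset_Icc_self ht))).resolve_left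
      (mul_pos ht.1 (sub_pos.2 ht.2)).ne')
  -- The weight gives no information at the endpoints; continuity of `f` does.
  have hf1 : EqOn f (fun _ => 0) (Icc 0 1) :=
    hf0.of_subset_closure hf.continuousOn continuousOn_const Ioo_subset_Icc_self
      (closure_Ioo zero_ne_one).ge
  intro t ht
  rw [← eq_neg_of_add_eq_zero_left (hf1 ht)]
  exact hdu t ht

end GeodesicOCP

theorem mainTheorem2 {n m : ℕ}
    (g : EuclideanSpace ℝ (Fin n) → EuclideanSpace ℝ (Fin m)) (hg : ContDiff ℝ ∞ g)
    (q₀ qN : EuclideanSpace ℝ (Fin n))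
    (u : ℝ → EuclideanSpace ℝ (Fin n)) (lam : ℝ → EuclideanSpace ℝ (Fin m))
    (q : ℝ → EuclideanSpace ℝ (Fin n))
    (hopt : GeodesicOCP.IsOptimal g q₀ qN u lam q) :
    ∃ p : ℝ → EuclideanSpace ℝ (Fin n),
      ContDiffOn ℝ ∞ p (Set.Icc 0 1) ∧
      (∀ t ∈ Set.Icc (0 : ℝ) 1,
        HasDerivWithinAt q (u t) (Set.Icc 0 1) t ∧
        HasDerivWithinAt p (-(ContinuousLinearMap.adjoint (fderiv ℝ g (q t)) (lam t)))
          (Set.Icc 0 1) t ∧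
        g (q t) = 0 ∧
        p t = u t) ∧
      q 0 = q₀ ∧ q 1 = qN := by
  exact ⟨u, hopt.1.smooth_control, fun t ht => ⟨hopt.1.state_eq t ht,
    hopt.hasDerivWithinAt_control hg t ht, hopt.constraint hg t ht, rfl⟩, hopt.1.left, hopt.1.right⟩
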